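/- Let $M$ be a smooth manifold of dimension $2n+1$ with a Riemannian metric $g$ and Levi-Civita connection $\nabla$, and let $R_{X,Y}Z=\nabla_X\nabla_YZ-\nabla_Y\nabla_XZ-\nabla_{[X,Y]}Z$. Let $f$ and $Q$ be smooth $(1,1)$-tensor fields on $M$ with $Q$ nonsingular, $\xi$ a smooth vector field and $\eta$ a smooth $1$-form such that $(f,Q,\xi,\eta,g)$ is a weak almost contact metric structure: $$f^2=-Q+\eta\otimes\xi,\qquad \eta(\xi)=1,\qquad g(fX,fY)=g(X,QY)-\eta(X)\eta(Y),\qquad \eta(X)=g(\xi,X).$$ Put $hX=\tfrac12\big([\xi,fX]-f[\xi,X]\big)$, and suppose that $M(f,Q,\xi,\eta,g)$ is a weak quasi-contact metric (weak q.c.m.) manifold, i.e. for all smooth vector fields $X,Y$, $$(\nabla_Xf)Y+(\nabla_{fX}f)fY=2\,g(X,Y)\,\xi-\eta(Y)\big(X+hX+\eta(X)\,\xi\big).$$ If $$R_{X,\xi}\,\xi=X-\eta(X)\,\xi\qquad\text{for all smooth vector fields } X,$$ and $\xi$ is a Killing vector field, i.e. $g(\nabla_X\xi,Y)+g(\nabla_Y\xi,X)=0$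 for all smooth vector fields $X,Y$, then $Q=\mathrm{id}$ and $M(f,\xi,\eta,g)$ is a K-contact manifold: $(f,\xi,\eta,g)$ is an almost contact metric structure (the equations of the first display hold with $Q=\mathrm{id}$), $d\eta(X,Y)=g(X,fY)$ for all smooth vector fields $X,Y$, where $2\,d\eta(X,Y)=X(\eta(Y))-Y(\eta(X))-\eta([X,Y])$, and $\xi$ is a Killing vector field. -/

import Mathlib

open Bundle
open scoped Manifold ContDiff

noncomputable section

set_option linter.unusedSectionVars false

namespace WeakQCM

variable {E : Type*} [NormedAddCommGroup E] [NormedSpace ℝ E]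
  {H : Type*} [TopologicalSpace H] {I : ModelWithCorners ℝ E H}
  {M : Type*} [TopologicalSpace M] [ChartedSpace H M]

/-! ### Tensor fields -/

/-- The vector field `X` is smooth, i.e. `X ∈ 𝔛(M)`. -/
def SmoothVF [IsManifold I ∞ M] (X : Π x : M, TangentSpace I x) : Prop :=
  ContMDiff I (I.prod 𝓘(ℝ, E)) ∞ (fun x ↦ TotalSpace.mk' E (E := (TangentSpace I : M → Type _)) x (X x))

/-- The `(1,1)`-tensor field `f` is smooth. -/
def SmoothEnd [IsManifold I ∞ M] (f : Π x : M, TangentSpace I x →L[ℝ] TangentSpace I x) : Prop :=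
  ContMDiff I (I.prod 𝓘(ℝ, E →L[ℝ] E)) ∞
    (fun x ↦ TotalSpace.mk' (E →L[ℝ] E)
      (E := fun x : M ↦ TangentSpace I x →L[ℝ] TangentSpace I x) x (f x))

/-- The `1`-form `η` is smooth. -/
def SmoothForm [IsManifold I ∞ M] (η : Π x : M, TangentSpace I x →L[ℝ] ℝ) : Prop :=
  ContMDiff I (I.prod 𝓘(ℝ, E →L[ℝ] ℝ)) ∞
    (fun x ↦ TotalSpace.mk' (E →L[ℝ] ℝ)
      (E := fun x : M ↦ TangentSpace I x →L[ℝ] ℝ) x (η x))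

/-- The vector field `fX`. -/
def app (f : Π x : M, TangentSpace I x →L[ℝ] TangentSpace I x) (X : Π x : M, TangentSpace I x) :
    Π x : M, TangentSpace I x :=
  fun x ↦ f x (X x)

variable [RiemannianBundle (fun x : M ↦ TangentSpace I x)]

/-! ### The Levi-Civita connection, constructed by the Koszul formula -/

/-- The function `g(X, Y)`. -/
def gfun (X Y : Π x : M, TangentSpace I x) : M → ℝ := fun x ↦ inner ℝ (X x) (Y x)

/-- Right-hand side of the Koszul formula for `2 g(∇_X Y, Z)`. -/
def koszul (X Y Z : Π x : M, TangentSpace I x) (x : M) : ℝ :=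
  mvfderiv I (gfun Y Z) x (X x) + mvfderiv I (gfun Z X) x (Y x) - mvfderiv I (gfun X Y) x (Z x)
  + inner ℝ (VectorField.mlieBracket I X Y x) (Z x)
  - inner ℝ (VectorField.mlieBracket I X Z x) (Y x)
  - inner ℝ (VectorField.mlieBracket I Y Z x) (X x)

section Koszul

variable {x : M} {X Y Z W : Π x : M, TangentSpace I x} {φ : M → ℝ}

lemma gfun_comm (X Y : Π x : M, TangentSpace I x) : gfun X Y = gfun Y X :=
  funext fun _ ↦ real_inner_comm _ _

lemma gfun_smul_left (φ : M → ℝ) (X Y : Π x : M, TangentSpace I x) :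
    gfun (φ • X) Y = φ * gfun X Y :=
  funext fun _ ↦ real_inner_smul_left _ _ _

lemma gfun_smul_right (φ : M → ℝ) (X Y : Π x : M, TangentSpace I x) :
    gfun X (φ • Y) = φ * gfun X Y :=
  funext fun _ ↦ real_inner_smul_right _ _ _

lemma gfun_add_left (X W Y : Π x : M, TangentSpace I x) :
    gfun (X + W) Y = gfun X Y + gfun W Y :=
  funext fun _ ↦ inner_add_left _ _ _

lemma gfun_add_right (X Y W : Π x : M, TangentSpace I x) :
    gfun X (Y + W) = gfun X Y + gfun X W :=
  funext fun _ ↦ inner_add_right _ _ _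

variable [IsManifold I ∞ M]
  [IsContMDiffRiemannianBundle I ∞ E (fun x : M ↦ TangentSpace I x)]

lemma mdiff_gfun (hX : MDiffAt (T% X) x) (hY : MDiffAt (T% Y) x) : MDiffAt (gfun X Y) x :=
  MDifferentiableAt.inner_bundle (IB := I) (F := E) (E := fun x : M ↦ TangentSpace I x)
    (b := fun x ↦ x) (v := X) (w := Y) hX hY

variable [CompleteSpace E]

lemma koszul_smul_left (hφ : MDiffAt φ x) (hX : MDiffAt (T% X) x) (hY : MDiffAt (T% Y) x)
    (hZ : MDiffAt (T% Z) x) : koszul (φ • X) Y Z x = φ x * koszul X Y Z x := by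
  simp only [koszul, gfun_smul_left, gfun_smul_right, mvfderiv_mul hφ (mdiff_gfun hZ hX),
    mvfderiv_mul hφ (mdiff_gfun hX hY), VectorField.mlieBracket_smul_left hφ hX]
  simp [gfun, inner_add_left, inner_smul_left, inner_smul_right, real_inner_comm (X x)]
  ring

lemma koszul_add_left (hX : MDiffAt (T% X) x) (hW : MDiffAt (T% W) x) (hY : MDiffAt (T% Y) x)
    (hZ : MDiffAt (T% Z) x) : koszul (X + W) Y Z x = koszul X Y Z x + koszul W Y Z x := by
  simp only [koszul, gfun_add_left, gfun_add_right,
    mvfderiv_add (mdiff_gfun hZ hX) (mdiff_gfun hZ hW),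
    mvfderiv_add (mdiff_gfun hX hY) (mdiff_gfun hW hY), VectorField.mlieBracket_add_left hX hW]
  simp [inner_add_left, inner_add_right]
  ring

lemma koszul_smul_right (hφ : MDiffAt φ x) (hX : MDiffAt (T% X) x) (hY : MDiffAt (T% Y) x)
    (hZ : MDiffAt (T% Z) x) : koszul X Y (φ • Z) x = φ x * koszul X Y Z x := by
  simp only [koszul, gfun_smul_left, gfun_smul_right, mvfderiv_mul hφ (mdiff_gfun hZ hX),
    mvfderiv_mul hφ (mdiff_gfun hY hZ), VectorField.mlieBracket_smul_right hφ hZ]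
  simp [gfun, inner_add_left, inner_smul_left, inner_smul_right, real_inner_comm (Z x)]
  ring

lemma koszul_add_right (hX : MDiffAt (T% X) x) (hW : MDiffAt (T% W) x) (hY : MDiffAt (T% Y) x)
    (hZ : MDiffAt (T% Z) x) : koszul X Y (Z + W) x = koszul X Y Z x + koszul X Y W x := by
  simp only [koszul, gfun_add_left, gfun_add_right,
    mvfderiv_add (mdiff_gfun hZ hX) (mdiff_gfun hW hX),
    mvfderiv_add (mdiff_gfun hY hZ) (mdiff_gfun hY hW), VectorField.mlieBracket_add_right hZ hW]
  simp [inner_add_left, inner_add_right]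
  ring

lemma koszul_smul_mid (hφ : MDiffAt φ x) (hX : MDiffAt (T% X) x) (hY : MDiffAt (T% Y) x)
    (hZ : MDiffAt (T% Z) x) :
    koszul X (φ • Y) Z x =
      φ x * koszul X Y Z x + 2 * mvfderiv I φ x (X x) * inner ℝ (Y x) (Z x) := by
  simp only [koszul, gfun_smul_left, gfun_smul_right, mvfderiv_mul hφ (mdiff_gfun hY hZ),
    mvfderiv_mul hφ (mdiff_gfun hX hY), VectorField.mlieBracket_smul_left hφ hY,
    VectorField.mlieBracket_smul_right hφ hY]
  simp [gfun, inner_add_left, inner_smul_left, inner_smul_right, real_inner_comm (Y x)]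
  ring

lemma koszul_add_mid (hX : MDiffAt (T% X) x) (hW : MDiffAt (T% W) x) (hY : MDiffAt (T% Y) x)
    (hZ : MDiffAt (T% Z) x) : koszul X (Y + W) Z x = koszul X Y Z x + koszul X W Z x := by
  simp only [koszul, gfun_add_left, gfun_add_right,
    mvfderiv_add (mdiff_gfun hY hZ) (mdiff_gfun hW hZ),
    mvfderiv_add (mdiff_gfun hX hY) (mdiff_gfun hX hW), VectorField.mlieBracket_add_left hY hW,
    VectorField.mlieBracket_add_right hY hW]
  simp [inner_add_left, inner_add_right]
  ring

end Koszul

variable [FiniteDimensional ℝ E] [IsManifold I ∞ M]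
  [IsContMDiffRiemannianBundle I ∞ E (fun x : M ↦ TangentSpace I x)]

lemma completeSpace_model (E : Type*) [NormedAddCommGroup E] [NormedSpace ℝ E]
    [FiniteDimensional ℝ E] : CompleteSpace E := FiniteDimensional.complete ℝ E

/-- The bilinear form `(X, Z) ↦ 2 g(∇_X Y, Z)` at `x`, for `Y` differentiable at `x`. -/
def koszulHom (Y : Π x : M, TangentSpace I x) (x : M)
    (hY : MDiffAt (T% Y) x) : TangentSpace I x →L[ℝ] TangentSpace I x →L[ℝ] ℝ :=
  haveI := completeSpace_model E
  TensorialAt.mkHom₂ (I := I) (F := E) (F' := E) (fun X Z ↦ koszul X Y Z x) x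
    (fun _ hZ ↦ ⟨fun hφ hX ↦ koszul_smul_left hφ hX hY hZ,
      fun hX hW ↦ koszul_add_left hX hW hY hZ⟩)
    (fun _ hX ↦ ⟨fun hφ hZ ↦ koszul_smul_right hφ hX hY hZ,
      fun hZ hW ↦ koszul_add_right hX hW hY hZ⟩)

lemma koszulHom_apply {X Y Z : Π x : M, TangentSpace I x} {x : M} (hX : MDiffAt (T% X) x)
    (hY : MDiffAt (T% Y) x) (hZ : MDiffAt (T% Z) x) :
    koszulHom Y x hY (X x) (Z x) = koszul X Y Z x := by
  unfold koszulHom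
  rw [TensorialAt.mkHom₂_apply _ _ hX hZ]

/-- The vector representing a linear form on `T_x M` through the metric. -/
def sharp (x : M) (α : TangentSpace I x →L[ℝ] ℝ) : TangentSpace I x :=
  haveI : FiniteDimensional ℝ (TangentSpace I x) := inferInstanceAs (FiniteDimensional ℝ E)
  haveI : CompleteSpace (TangentSpace I x) := FiniteDimensional.complete ℝ _
  (InnerProductSpace.toDual ℝ (TangentSpace I x)).symm α

lemma inner_sharp (x : M) (α : TangentSpace I x →L[ℝ] ℝ) (v : TangentSpace I x) :
    inner ℝ (sharp x α) v = α v := by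
  have : FiniteDimensional ℝ (TangentSpace I x) := inferInstanceAs (FiniteDimensional ℝ E)
  have : CompleteSpace (TangentSpace I x) := FiniteDimensional.complete ℝ _
  exact InnerProductSpace.toDual_symm_apply

open Classical in
/-- The vector `∇_u Y ∈ T_x M`, determined by `2 g(∇_u Y, Z) = koszul u Y Z`
(and `0` if the vector field `Y` is not differentiable at `x`). -/
def lcVector (Y : Π x : M, TangentSpace I x) (x : M) (u : TangentSpace I x) : TangentSpace I x :=
  if hY : MDiffAt (T% Y) x then (2⁻¹ : ℝ) • sharp x (koszulHom Y x hY u) else 0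

lemma inner_lcVector {X Y Z : Π x : M, TangentSpace I x} {x : M} (hX : MDiffAt (T% X) x)
    (hY : MDiffAt (T% Y) x) (hZ : MDiffAt (T% Z) x) :
    inner ℝ (lcVector Y x (X x)) (Z x) = 2⁻¹ * koszul X Y Z x := by
  rw [lcVector, dif_pos hY, real_inner_smul_left, inner_sharp, koszulHom_apply hX hY hZ]

lemma inner_lcVector' {Y : Π x : M, TangentSpace I x} {x : M} (hY : MDiffAt (T% Y) x)
    (u v : TangentSpace I x) :
    inner ℝ (lcVector Y x u) v = 2⁻¹ * koszulHom Y x hY u v := by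
  rw [lcVector, dif_pos hY, real_inner_smul_left, inner_sharp]

/-- `u ↦ ∇_u Y` as a continuous linear endomorphism of `T_x M`. -/
def lcFun (Y : Π x : M, TangentSpace I x) (x : M) : TangentSpace I x →L[ℝ] TangentSpace I x :=
  haveI : FiniteDimensional ℝ (TangentSpace I x) := inferInstanceAs (FiniteDimensional ℝ E)
  LinearMap.toContinuousLinearMap
    { toFun := lcVector Y x
      map_add' := fun u v ↦ by
        by_cases hY : MDiffAt (T% Y) x
        · refine ext_inner_right ℝ fun w ↦ ?_
          rw [inner_add_left, inner_lcVector' hY, inner_lcVector' hY, inner_lcVector' hY, map_add,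
            _root_.add_apply, mul_add]
        · simp [lcVector, hY]
      map_smul' := fun c u ↦ by
        by_cases hY : MDiffAt (T% Y) x
        · refine ext_inner_right ℝ fun w ↦ ?_
          rw [RingHom.id_apply, real_inner_smul_left, inner_lcVector' hY, inner_lcVector' hY,
            map_smul, _root_.smul_apply, smul_eq_mul]
          ring
        · simp [lcVector, hY] }

lemma lcFun_apply (Y : Π x : M, TangentSpace I x) (x : M) (u : TangentSpace I x) :
    lcFun Y x u = lcVector Y x u := rfl

/-- To identify a tangent vector it is enough to pair it with differentiable vector fields. -/
lemma ext_inner_field {x : M} {u v : TangentSpace I x}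
    (h : ∀ Z : Π x : M, TangentSpace I x, MDiffAt (T% Z) x →
      inner ℝ u (Z x) = inner ℝ v (Z x)) : u = v := by
  refine ext_inner_right ℝ fun w ↦ ?_
  have := h (FiberBundle.extend E w) (FiberBundle.mdifferentiableAt_extend I E w)
  simpa using this

lemma ext_field {x : M} {A B : TangentSpace I x →L[ℝ] TangentSpace I x}
    (h : ∀ X : Π x : M, TangentSpace I x, MDiffAt (T% X) x → A (X x) = B (X x)) : A = B := by
  refine ContinuousLinearMap.ext fun w ↦ ?_
  have := h (FiberBundle.extend E w) (FiberBundle.mdifferentiableAt_extend I E w)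
  simpa using this

lemma isCovariantDerivativeOn_lcFun :
    IsCovariantDerivativeOn E (I := I) (V := fun x : M ↦ TangentSpace I x)
      (fun Y x ↦ lcFun Y x) Set.univ where
  add {Y W x} hY hW _ := by
    have := completeSpace_model E
    refine ext_field fun X hX ↦ ext_inner_field fun Z hZ ↦ ?_
    have hYW : MDiffAt (T% (Y + W)) x := mdifferentiableAt_add_section hY hW
    rw [_root_.add_apply, inner_add_left, lcFun_apply, lcFun_apply, lcFun_apply,
      inner_lcVector hX hYW hZ, inner_lcVector hX hY hZ, inner_lcVector hX hW hZ,
      koszul_add_mid hX hW hY hZ, mul_add]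
  leibniz {Y φ x} hY hφ _ := by
    have := completeSpace_model E
    refine ext_field fun X hX ↦ ext_inner_field fun Z hZ ↦ ?_
    have hφY : MDiffAt (T% (φ • Y)) x := hφ.smul_section hY
    rw [_root_.add_apply, inner_add_left, _root_.smul_apply,
      ContinuousLinearMap.smulRight_apply, real_inner_smul_left, real_inner_smul_left,
      lcFun_apply, lcFun_apply, inner_lcVector hX hφY hZ, inner_lcVector hX hY hZ,
      koszul_smul_mid hφ hX hY hZ]
    ring

variable (I M) in
/-- The Levi-Civita connection of the Riemannian manifold `M`. -/
def leviCivita : CovariantDerivative I E (fun x : M ↦ TangentSpace I x) where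
  toFun Y x := lcFun Y x
  isCovariantDerivativeOnUniv := isCovariantDerivativeOn_lcFun

/-- The vector field `∇_X Y`. -/
def nabla (X Y : Π x : M, TangentSpace I x) : Π x : M, TangentSpace I x :=
  fun x ↦ leviCivita I M Y x (X x)

lemma inner_nabla {X Y Z : Π x : M, TangentSpace I x} {x : M} (hX : MDiffAt (T% X) x)
    (hY : MDiffAt (T% Y) x) (hZ : MDiffAt (T% Z) x) :
    inner ℝ (nabla X Y x) (Z x) = 2⁻¹ * koszul X Y Z x :=
  inner_lcVector hX hY hZ

/-- The connection is torsion-free. -/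
lemma nabla_sub_nabla {X Y : Π x : M, TangentSpace I x} {x : M} (hX : MDiffAt (T% X) x)
    (hY : MDiffAt (T% Y) x) :
    nabla X Y x - nabla Y X x = VectorField.mlieBracket I X Y x := by
  refine ext_inner_field fun Z hZ ↦ ?_
  rw [inner_sub_left, inner_nabla hX hY hZ, inner_nabla hY hX hZ]
  simp only [koszul, gfun_comm X Z, gfun_comm Z Y, gfun_comm Y X,
    VectorField.mlieBracket_swap_apply (V := Y) (W := X), inner_neg_left]
  ring

/-- The connection is compatible with the metric. -/
lemma mvfderiv_gfun {X Y Z : Π x : M, TangentSpace I x} {x : M} (hX : MDiffAt (T% X) x)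
    (hY : MDiffAt (T% Y) x) (hZ : MDiffAt (T% Z) x) :
    mvfderiv I (gfun Y Z) x (X x) =
      inner ℝ (nabla X Y x) (Z x) + inner ℝ (Y x) (nabla X Z x) := by
  rw [real_inner_comm (nabla X Z x), inner_nabla hX hY hZ, inner_nabla hX hZ hY]
  simp only [koszul, gfun_comm Y Z, gfun_comm Y X, gfun_comm Z X,
    VectorField.mlieBracket_swap_apply (V := Z) (W := Y), inner_neg_left]
  ring

/-- The curvature tensor `R_{X,Y} Z = ∇_X ∇_Y Z - ∇_Y ∇_X Z - ∇_{[X,Y]} Z`. -/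
def curvature (X Y Z : Π x : M, TangentSpace I x) : Π x : M, TangentSpace I x :=
  fun x ↦ nabla X (nabla Y Z) x - nabla Y (nabla X Z) x
    - nabla (VectorField.mlieBracket I X Y) Z x

/-- The covariant derivative of a `(1,1)`-tensor, `(∇_X f)Y = ∇_X (fY) - f(∇_X Y)`. -/
def nablaEnd (f : Π x : M, TangentSpace I x →L[ℝ] TangentSpace I x)
    (X Y : Π x : M, TangentSpace I x) : Π x : M, TangentSpace I x :=
  fun x ↦ nabla X (app f Y) x - f x (nabla X Y x)

/-- The vector field `ξ` is Killing: `g(∇_X ξ, Y) + g(∇_Y ξ, X) = 0`. -/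
def IsKilling (ξ : Π x : M, TangentSpace I x) : Prop :=
  ∀ X Y : Π x : M, TangentSpace I x, SmoothVF X → SmoothVF Y →
    ∀ x, (inner ℝ (nabla X ξ x) (Y x) + inner ℝ (nabla Y ξ x) (X x) : ℝ) = 0

/-! ### Weak quasi-contact metric structures -/

/-- The Lie derivative of a `(1,1)`-tensor, `(L_Z f)X = [Z, fX] - f[Z, X]`. -/
def lieEnd (Z : Π x : M, TangentSpace I x) (f : Π x : M, TangentSpace I x →L[ℝ] TangentSpace I x)
    (X : Π x : M, TangentSpace I x) : Π x : M, TangentSpace I x :=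
  fun x ↦ VectorField.mlieBracket I Z (app f X) x - f x (VectorField.mlieBracket I Z X x)

/-- The tensor `h = (1/2) L_ξ f`. -/
def hTensor (f : Π x : M, TangentSpace I x →L[ℝ] TangentSpace I x)
    (ξ X : Π x : M, TangentSpace I x) : Π x : M, TangentSpace I x :=
  fun x ↦ (1 / 2 : ℝ) • lieEnd ξ f X x

/-- The exterior derivative of a `1`-form, with the convention
`2 dη(X, Y) = X(η(Y)) - Y(η(X)) - η([X, Y])`. -/
def dForm (η : Π x : M, TangentSpace I x →L[ℝ] ℝ) (X Y : Π x : M, TangentSpace I x) (x : M) : ℝ :=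
  (1 / 2 : ℝ) * (mvfderiv I (fun y ↦ η y (Y y)) x (X x) - mvfderiv I (fun y ↦ η y (X y)) x (Y x)
    - η x (VectorField.mlieBracket I X Y x))

/-- `(f, Q, ξ, η, g)` is a weak almost contact metric structure, where `g` is the metric of `M`. -/
structure IsWeakACM (f Q : Π x : M, TangentSpace I x →L[ℝ] TangentSpace I x)
    (ξ : Π x : M, TangentSpace I x) (η : Π x : M, TangentSpace I x →L[ℝ] ℝ) : Prop where
  smooth_f : SmoothEnd f
  smooth_Q : SmoothEnd Q
  smooth_xi : SmoothVF ξ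
  smooth_eta : SmoothForm η
  nonsingular : ∀ x, Function.Bijective (Q x)
  f_sq : ∀ x (u : TangentSpace I x), f x (f x u) = -Q x u + η x u • ξ x
  eta_xi : ∀ x, η x (ξ x) = 1
  compat : ∀ x (u v : TangentSpace I x),
    (inner ℝ (f x u) (f x v) : ℝ) = inner ℝ u (Q x v) - η x u * η x v
  eta_eq : ∀ x (u : TangentSpace I x), η x u = inner ℝ (ξ x) u

/-- `(f, Q, ξ, η, g)` is a weak quasi-contact metric structure. -/
structure IsWeakQCM (f Q : Π x : M, TangentSpace I x →L[ℝ] TangentSpace I x)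
    (ξ : Π x : M, TangentSpace I x) (η : Π x : M, TangentSpace I x →L[ℝ] ℝ) : Prop
    extends IsWeakACM f Q ξ η where
  quasi : ∀ X Y : Π x : M, TangentSpace I x, SmoothVF X → SmoothVF Y → ∀ x,
    nablaEnd f X Y x + nablaEnd f (app f X) (app f Y) x =
      (2 * inner ℝ (X x) (Y x) : ℝ) • ξ x
        - η x (Y x) • (X x + hTensor f ξ X x + η x (X x) • ξ x)

/-- `(f, ξ, η, g)` is an almost contact metric structure, i.e. a weak one with `Q = id`. -/
def IsACM (f : Π x : M, TangentSpace I x →L[ℝ] TangentSpace I x)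
    (ξ : Π x : M, TangentSpace I x) (η : Π x : M, TangentSpace I x →L[ℝ] ℝ) : Prop :=
  IsWeakACM f (fun x ↦ ContinuousLinearMap.id ℝ (TangentSpace I x)) ξ η

/-- `(f, ξ, η, g)` is a contact metric structure: an almost contact metric structure with
`dη(X, Y) = g(X, fY)`. -/
structure IsContactMetric (f : Π x : M, TangentSpace I x →L[ℝ] TangentSpace I x)
    (ξ : Π x : M, TangentSpace I x) (η : Π x : M, TangentSpace I x →L[ℝ] ℝ) : Prop where
  acm : IsACM f ξ η
  contact : ∀ X Y : Π x : M, TangentSpace I x, SmoothVF X → SmoothVF Y → ∀ x,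
    dForm η X Y x = inner ℝ (X x) (f x (Y x))

/-- `M(f, ξ, η, g)` is a K-contact manifold: a contact metric manifold with `ξ` Killing. -/
structure IsKContact (f : Π x : M, TangentSpace I x →L[ℝ] TangentSpace I x)
    (ξ : Π x : M, TangentSpace I x) (η : Π x : M, TangentSpace I x →L[ℝ] ℝ) : Prop where
  contactMetric : IsContactMetric f ξ η
  killing : IsKilling ξ

end WeakQCM

end

set_option linter.unusedSectionVars false

/-! Write A = ∇ξ and T = ∇f. Geometry enters only through a few pointwise facts about A, f and T;
the conclusion is then linear algebra on one tangent space (`eq_id_and_eq_neg`).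

The compatibility condition gives fᵀf = -f², which forces f to be skew, so each T_X is skew too.
Since the dimension is odd, f has a kernel vector w ≠ 0. At X = w the quasi-contact identity loses
its second term, and skewness of T_w makes w a multiple of ξ; hence fξ = 0 (`IsWeakQCM.f_xi`), and
so T_X ξ = -fAX.

The Killing condition makes A skew, and Aξ = 0 because ξ has unit length. The symmetric part of the
curvature hypothesis reads A² = -id + η ⊗ ξ (`IsKilling.leviCivita_sq`).

Evaluating the quasi-contact identity at Y = ξ gives fA + Af = 2(id - η ⊗ ξ); pairing it with ξ
gives fA - f²Af = 2(id - η ⊗ ξ). Comparing the two yields QAf = Af, from which Q = id. Then f + A is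
skew with square zero, so A = -f. As dη is the skew part of ∇ξ, this is the contact condition. -/

namespace WeakQCM

/-! ### Linear algebra on a single tangent space -/

section Algebra

variable {V : Type*} [NormedAddCommGroup V] [InnerProductSpace ℝ V]

/-- An endomorphism `f` with `fᵀ f = -f²` is skew-symmetric. -/
lemma skew_of_inner_map_map [FiniteDimensional ℝ V] {f : V →ₗ[ℝ] V}
    (h : ∀ u v, (inner ℝ (f u) (f v) : ℝ) = -inner ℝ u (f (f v))) (u v : V) :
    (inner ℝ (f u) v : ℝ) = -inner ℝ u (f v) := by
  set B : V →ₗ[ℝ] V := f + LinearMap.adjoint f with hB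
  have hBf (v : V) : B (f v) = 0 := by
    refine ext_inner_left ℝ fun u ↦ ?_
    rw [hB, LinearMap.add_apply, inner_add_right, LinearMap.adjoint_inner_right, h, inner_zero_right]
    ring
  have hsymm (u v : V) : (inner ℝ (B u) v : ℝ) = inner ℝ u (B v) := by
    rw [hB, LinearMap.add_apply, LinearMap.add_apply, inner_add_left, inner_add_right,
      LinearMap.adjoint_inner_left, LinearMap.adjoint_inner_right, add_comm]
  have hfB (u : V) : LinearMap.adjoint f (B u) = 0 := by
    refine ext_inner_right ℝ fun v ↦ ?_
    rw [LinearMap.adjoint_inner_left, hsymm, hBf, inner_zero_right, inner_zero_left]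
  -- Since B f = 0 and, by transposition, fᵀB = 0, we get B² = fB and B³ = BfB = 0. A symmetric
  -- operator with vanishing cube is zero.
  have hBBB (u : V) : B (B (B u)) = 0 := by
    have : B (B u) = f (B u) := by
      conv_lhs => rw [hB, LinearMap.add_apply, ← hB, hfB, add_zero]
    rw [this, hBf]
  have hBB (u : V) : B (B u) = 0 := by
    rw [← inner_self_eq_zero (𝕜 := ℝ), hsymm, hBBB, inner_zero_right]
  have hB0 (u : V) : B u = 0 := by
    rw [← inner_self_eq_zero (𝕜 := ℝ), hsymm, hBB, inner_zero_right]
  have := hB0 v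
  rw [hB, LinearMap.add_apply, add_eq_zero_iff_eq_neg] at this
  rw [this, inner_neg_right, LinearMap.adjoint_inner_right, neg_neg]

/-- A skew-symmetric endomorphism in odd dimension has a nontrivial kernel. -/
lemma exists_map_eq_zero_of_skew [FiniteDimensional ℝ V] (hV : Odd (Module.finrank ℝ V))
    {f : V →ₗ[ℝ] V} (h : ∀ u v, (inner ℝ (f u) v : ℝ) = -inner ℝ u (f v)) :
    ∃ w, w ≠ 0 ∧ f w = 0 := by
  have hadj : LinearMap.adjoint f = (-1 : ℝ) • f := by
    refine LinearMap.ext fun v ↦ ext_inner_left ℝ fun u ↦ ?_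
    rw [LinearMap.adjoint_inner_right, h, LinearMap.smul_apply, real_inner_smul_right]
    ring
  have hdet : LinearMap.det f = -LinearMap.det f := by
    have b := stdOrthonormalBasis ℝ V
    have h1 : LinearMap.det (LinearMap.adjoint f) = LinearMap.det f := by
      rw [← LinearMap.det_toMatrix b.toBasis, ← LinearMap.det_toMatrix b.toBasis,
        LinearMap.toMatrix_adjoint, Matrix.det_conjTranspose, star_trivial]
    rw [hadj, LinearMap.det_smul, hV.neg_one_pow] at h1
    linarith
  have := LinearMap.bot_lt_ker_of_det_eq_zero (show LinearMap.det f = 0 by linarith)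
  obtain ⟨w, hw, hw0⟩ := Submodule.exists_mem_ne_zero_of_ne_bot this.ne'
  exact ⟨w, hw0, hw⟩

/-- If `S = 2 ⟨w, ·⟩ ξ - ⟨ξ, ·⟩ (w + a + ⟨ξ, w⟩ ξ)` is skew-symmetric, where `f w = 0` and `a ⟂ w`,
then `w` is a multiple of `ξ`, and therefore `f ξ = 0`. -/
lemma map_xi_eq_zero {f Q : V →ₗ[ℝ] V} {ξ w a : V} {S : V → V}
    (hQ : Function.Injective Q) (hξ : (inner ℝ ξ ξ : ℝ) = 1)
    (f_sq : ∀ u, f (f u) = -Q u + (inner ℝ ξ u : ℝ) • ξ)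
    (hw0 : w ≠ 0) (hw : f w = 0) (ha : (inner ℝ a w : ℝ) = 0)
    (hS : ∀ v, S v = (2 * inner ℝ w v : ℝ) • ξ
      - (inner ℝ ξ v : ℝ) • (w + a + (inner ℝ ξ w : ℝ) • ξ))
    (hskew : ∀ v, (inner ℝ (S v) v : ℝ) = 0) : f ξ = 0 := by
  set t : ℝ := inner ℝ ξ w with ht
  have hQw : Q w = t • ξ := by
    have := f_sq w
    rw [hw, map_zero, ← ht] at this
    rw [← sub_eq_zero, ← neg_eq_zero, neg_sub, sub_eq_neg_add, ← this]
  -- Only injectivity of Q is needed: t = 0 would give Q w = 0.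
  have ht0 : t ≠ 0 := fun h ↦ hw0 (hQ (by rw [hQw, h, zero_smul, map_zero]))
  set p : V := w - a - t • ξ with hp
  -- ⟨S v, v⟩ factors as ⟨ξ, v⟩⟨p, v⟩. The choice v = ξ gives p ⟂ ξ, and v = ξ + p, whose
  -- ξ-component is 1, gives |p|² = 0.
  have key (v : V) : (inner ℝ ξ v : ℝ) * inner ℝ p v = 0 := by
    have := hskew v
    rw [hS, inner_sub_left, real_inner_smul_left, real_inner_smul_left, inner_add_left,
      inner_add_left, real_inner_smul_left] at this
    rw [hp, inner_sub_left, inner_sub_left, real_inner_smul_left]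
    linarith
  have hpξ : (inner ℝ p ξ : ℝ) = 0 := by
    have := key ξ
    rwa [hξ, one_mul] at this
  have hpp : p = 0 := by
    have := key (ξ + p)
    rw [inner_add_right, inner_add_right, hξ, real_inner_comm, hpξ] at this
    simpa using this
  have haw : a = w - t • ξ := by
    rw [hp, sub_right_comm, sub_eq_zero] at hpp
    exact hpp.symm
  have hww : (inner ℝ w w : ℝ) = t * t := by
    rw [haw, inner_sub_left, real_inner_smul_left, ← ht] at ha
    linarith
  -- Equality case of Cauchy–Schwarz: |w|² = ⟨ξ, w⟩² with ξ a unit vector.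
  have hwξ : w - t • ξ = 0 := by
    rw [← inner_self_eq_zero (𝕜 := ℝ), inner_sub_left, inner_sub_right, inner_sub_right,
      real_inner_smul_left, real_inner_smul_left, real_inner_smul_right, real_inner_smul_right,
      hww, hξ, ← ht, real_inner_comm, ← ht]
    ring
  have : t • f ξ = 0 := by rw [← map_smul, ← sub_eq_zero.mp hwξ, hw]
  exact (smul_eq_zero.mp this).resolve_left ht0

/-- The pointwise algebra of a weak quasi-contact metric structure with Killing `ξ` of unit
`ξ`-sectional curvature: `A` stands for `∇ξ` and `T` for `∇f`. -/
lemma eq_id_and_eq_neg {f Q A : V →ₗ[ℝ] V} {ξ : V} {T : V → V → V}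
    (hQ : Function.Injective Q) (hξ : (inner ℝ ξ ξ : ℝ) = 1)
    (f_sq : ∀ u, f (f u) = -Q u + (inner ℝ ξ u : ℝ) • ξ)
    (f_skew : ∀ u v, (inner ℝ (f u) v : ℝ) = -inner ℝ u (f v)) (hfξ : f ξ = 0)
    (A_skew : ∀ u v, (inner ℝ (A u) v : ℝ) = -inner ℝ u (A v)) (hAξ : A ξ = 0)
    (A_sq : ∀ u, A (A u) = -u + (inner ℝ ξ u : ℝ) • ξ)
    (T_zero : ∀ v, T 0 v = 0)
    (T_skew : ∀ u v w, (inner ℝ (T u v) w : ℝ) = -inner ℝ v (T u w))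
    (T_xi : ∀ u, T u ξ = -f (A u))
    (quasi : ∀ u v, T u v + T (f u) (f v) = (2 * inner ℝ u v : ℝ) • ξ
      - (inner ℝ ξ v : ℝ) • (u + (1 / 2 : ℝ) • (T ξ u - A (f u) + f (A u))
        + (inner ℝ ξ u : ℝ) • ξ)) :
    (∀ u, Q u = u) ∧ ∀ u, A u = -f u := by
  have T_zero' (u : V) : T u 0 = 0 := by
    refine ext_inner_right ℝ fun w ↦ ?_
    rw [T_skew, inner_zero_left, inner_zero_left, neg_zero]
  have hfη (u : V) : (inner ℝ ξ (f u) : ℝ) = 0 := by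
    have := f_skew ξ u
    rw [hfξ, inner_zero_left] at this
    linarith
  have hAη (u : V) : (inner ℝ ξ (A u) : ℝ) = 0 := by
    have := A_skew ξ u
    rw [hAξ, inner_zero_left] at this
    linarith
  have hTξ (v : V) : T ξ v = 0 := by
    have := quasi ξ v
    rw [hfξ, T_zero, T_xi, hAξ, map_zero, map_zero, hξ] at this
    simp only [add_zero, neg_zero, sub_zero, smul_zero, one_smul] at this
    rw [this]
    module
  have anti (u : V) : f (A u) + A (f u) = (2 : ℝ) • (u - (inner ℝ ξ u : ℝ) • ξ) := by
    have := quasi u ξ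
    rw [hfξ, T_zero', T_xi, hTξ, hξ, real_inner_comm] at this
    linear_combination (norm := module) (-2 : ℝ) • this
  have hQAf (u : V) : Q (A (f u)) = A (f u) := by
    have hQA : f (f (A (f u))) = -Q (A (f u)) := by rw [f_sq, hAη, zero_smul, add_zero]
    -- The ξ-component of `quasi u v`: skewness of T turns ⟨T u v, ξ⟩ into ⟨v, f A u⟩, and the
    -- h-term drops out because T ξ = 0 and the images of f and A are orthogonal to ξ.
    have h1 : f (A u) - f (f (A (f u))) = (2 : ℝ) • (u - (inner ℝ ξ u : ℝ) • ξ) := by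
      refine ext_inner_left ℝ fun v ↦ ?_
      have := congrArg (fun z ↦ (inner ℝ z ξ : ℝ)) (quasi u v)
      simp only [inner_add_left, inner_sub_left, real_inner_smul_left, T_skew, T_xi, hTξ, hξ,
        inner_zero_left, real_inner_comm ξ (f _), real_inner_comm ξ (A _), hAη, hfη,
        inner_neg_right, map_neg, neg_neg, f_skew v] at this
      rw [real_inner_comm ξ u] at this
      rw [inner_sub_right, inner_smul_right, inner_sub_right, inner_smul_right, real_inner_comm u v,
        real_inner_comm ξ v]
      linarith
    rw [hQA, ← anti u, sub_neg_eq_add] at h1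
    exact add_left_cancel h1
  have hQξ : Q ξ = ξ := by
    have := f_sq ξ
    rw [hfξ, map_zero, hξ, one_smul] at this
    rw [← sub_eq_zero, ← neg_eq_zero, neg_sub, sub_eq_neg_add, ← this]
  have hQ_symm (u v : V) : (inner ℝ (Q u) v : ℝ) = inner ℝ u (Q v) := by
    have h1 : (inner ℝ (f (f u)) v : ℝ) = inner ℝ u (f (f v)) := by
      rw [f_skew, f_skew, neg_neg]
    rw [f_sq, f_sq, inner_add_left, inner_add_right, inner_neg_left, inner_neg_right,
      real_inner_smul_left, real_inner_smul_right, real_inner_comm ξ u] at h1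
    linarith
  have hQid (u : V) : Q u = u := by
    have hη : (inner ℝ ξ (Q u - u) : ℝ) = 0 := by
      rw [inner_sub_right, ← hQ_symm, hQξ, sub_self]
    -- The transpose of fA is Af, so Q Af = Af with Q symmetric says that fA kills the image of Q -
    -- id. Next f² = -Q on the image of A shows that A kills it, and A² = -id on the complement of ξ
    -- shows that it is zero.
    have hfA : f (A (Q u - u)) = 0 := by
      refine ext_inner_right ℝ fun v ↦ ?_
      rw [f_skew, A_skew, neg_neg, inner_sub_left, hQ_symm, hQAf, sub_self, inner_zero_left]
    have hA : A (Q u - u) = 0 := by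
      have := f_sq (A (Q u - u))
      rw [hfA, map_zero, hAη, zero_smul, add_zero, eq_comm, neg_eq_zero] at this
      exact hQ (by rw [this, map_zero])
    have := A_sq (Q u - u)
    rw [hA, map_zero, hη, zero_smul, add_zero, eq_comm, neg_eq_zero] at this
    exact sub_eq_zero.mp this
  refine ⟨hQid, fun u ↦ ?_⟩
  -- Once Q = id, f² and A² both equal -id + η ⊗ ξ, and the anticommutator cancels their sum.
  have hsq (u : V) : f (f u + A u) + A (f u + A u) = 0 := by
    have := anti u
    rw [map_add, map_add, f_sq, A_sq, hQid]
    linear_combination (norm := module) this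
  rw [eq_neg_iff_add_eq_zero, add_comm, ← inner_self_eq_zero (𝕜 := ℝ)]
  have : (inner ℝ (f u + A u) (f u + A u) : ℝ) = -inner ℝ u (f (f u + A u) + A (f u + A u)) := by
    rw [inner_add_left, f_skew, A_skew, inner_add_right u]
    ring
  rw [this, hsq, inner_zero_right, neg_zero]

end Algebra

open Filter Topology

/-! ### Global smooth vector fields and their brackets -/

section Smooth

variable {E : Type*} [NormedAddCommGroup E] [NormedSpace ℝ E] [FiniteDimensional ℝ E]
  {H : Type*} [TopologicalSpace H] {I : ModelWithCorners ℝ E H}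
  {M : Type*} [TopologicalSpace M] [ChartedSpace H M] [IsManifold I ∞ M]
  {X Y Z ξ : Π x : M, TangentSpace I x} {f : Π x : M, TangentSpace I x →L[ℝ] TangentSpace I x}

lemma SmoothVF.mdiffAt (hX : SmoothVF X) (x : M) : MDiffAt (T% X) x :=
  (ContMDiff.contMDiffAt hX).mdifferentiableAt (by simp)

/-- Every tangent vector is the value of a global smooth vector field. -/
lemma exists_smoothVF [T2Space M] (x : M) (v : TangentSpace I x) :
    ∃ X : Π x : M, TangentSpace I x, SmoothVF X ∧ X x = v := by
  obtain ⟨s, hs, hsmooth⟩ := FiberBundle.exists_contMDiffOn_extend (k := ∞) I E v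
  obtain ⟨ψ, -, hψ⟩ := (SmoothBumpFunction.nhds_basis_tsupport (I := I) x).mem_iff.mp
    (interior_mem_nhds.mpr hs)
  refine ⟨(ψ : M → ℝ) • FiberBundle.extend E v, ?_, ?_⟩
  · exact ContMDiffOn.smul_section_of_tsupport ψ.contMDiff.contMDiffOn isOpen_interior hψ
      (hsmooth.mono interior_subset)
  · simp

lemma SmoothEnd.app (hf : SmoothEnd f) (hX : SmoothVF X) : SmoothVF (app f X) :=
  ContMDiff.clm_bundle_apply (F₁ := E) (F₂ := E) hf hX

lemma SmoothVF.mlieBracket (hX : SmoothVF X) (hY : SmoothVF Y) :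
    SmoothVF (VectorField.mlieBracket I X Y) := by
  have := completeSpace_model E
  -- The bracket costs one derivative, which is harmless because ∞ + 1 = ∞.
  have : IsManifold I (((⊤ : ℕ∞) : WithTop ℕ∞) + 1) M := by simpa using ‹IsManifold I ∞ M›
  have : IsManifold I (minSmoothness ℝ 2) M := by
    rw [minSmoothness_of_isRCLikeNormedField]; infer_instance
  have : IsManifold I (minSmoothness ℝ 3) M := by
    rw [minSmoothness_of_isRCLikeNormedField]; infer_instance
  exact fun x ↦ ContMDiffAt.mlieBracket_vectorField (m := ⊤) (n := ⊤) (hX x) (hY x) (by simp)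

lemma SmoothVF.contMDiff_mvfderiv {φ : M → ℝ} (hφ : ContMDiff I 𝓘(ℝ, ℝ) ∞ φ) (hX : SmoothVF X) :
    ContMDiff I 𝓘(ℝ, ℝ) ∞ (fun x ↦ mvfderiv I φ x (X x)) :=
  (contMDiff_snd_tangentBundle_modelSpace ℝ 𝓘(ℝ, ℝ)).comp
    ((hφ.contMDiff_tangentMap (m := ∞) (by simp)).comp hX)

end Smooth

/-! ### Smoothness of `∇_X Y`, read off from the Koszul formula -/

section Metric

variable {E : Type*} [NormedAddCommGroup E] [NormedSpace ℝ E] [FiniteDimensional ℝ E]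
  {H : Type*} [TopologicalSpace H] {I : ModelWithCorners ℝ E H}
  {M : Type*} [TopologicalSpace M] [ChartedSpace H M] [IsManifold I ∞ M]
  [RiemannianBundle (fun x : M ↦ TangentSpace I x)]
  [IsContMDiffRiemannianBundle I ∞ E (fun x : M ↦ TangentSpace I x)]
  {X Y Z ξ : Π x : M, TangentSpace I x} {f : Π x : M, TangentSpace I x →L[ℝ] TangentSpace I x}

lemma SmoothVF.gfun (hX : SmoothVF X) (hY : SmoothVF Y) :
    ContMDiff I 𝓘(ℝ, ℝ) ∞ (gfun X Y) :=
  ContMDiff.inner_bundle (IB := I) (F := E) (E := fun x : M ↦ TangentSpace I x)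
    (b := fun x ↦ x) (v := X) (w := Y) hX hY

lemma SmoothVF.koszul (hX : SmoothVF X) (hY : SmoothVF Y) (hZ : SmoothVF Z) :
    ContMDiff I 𝓘(ℝ, ℝ) ∞ (koszul X Y Z) :=
  (((((hX.contMDiff_mvfderiv (hY.gfun hZ)).add (hY.contMDiff_mvfderiv (hZ.gfun hX))).sub
    (hZ.contMDiff_mvfderiv (hX.gfun hY))).add ((hX.mlieBracket hY).gfun hZ)).sub
    ((hX.mlieBracket hZ).gfun hY)).sub ((hY.mlieBracket hZ).gfun hX)

lemma contMDiffAt_det {ι : Type*} [Fintype ι] [DecidableEq ι] {G : M → Matrix ι ι ℝ} {x : M}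
    (hG : ∀ i j, ContMDiffAt I 𝓘(ℝ, ℝ) ∞ (fun y ↦ G y i j) x) :
    ContMDiffAt I 𝓘(ℝ, ℝ) ∞ (fun y ↦ (G y).det) x := by
  simp only [Matrix.det_apply']
  exact ContMDiffAt.sum fun σ _ ↦
    contMDiffAt_const.mul (contMDiffAt_finsetProd fun i _ ↦ hG _ _)

/-- A vector field is smooth as soon as its scalar products with smooth vector fields are. -/
lemma smoothVF_of_gfun [T2Space M]
    (h : ∀ Z : Π x : M, TangentSpace I x, SmoothVF Z → ContMDiff I 𝓘(ℝ, ℝ) ∞ (gfun X Z)) :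
    SmoothVF X := by
  intro x
  have hfin (y : M) : FiniteDimensional ℝ (TangentSpace I y) :=
    inferInstanceAs (FiniteDimensional ℝ E)
  let b : Module.Basis (Fin (Module.finrank ℝ E)) ℝ (TangentSpace I x) := Module.finBasis ℝ E
  choose s hs hsx using fun i ↦ exists_smoothVF x (b i)
  let G : M → Matrix (Fin (Module.finrank ℝ E)) (Fin (Module.finrank ℝ E)) ℝ :=
    fun y ↦ Matrix.gram ℝ fun i ↦ s i y
  have hG (i j) : ContMDiffAt I 𝓘(ℝ, ℝ) ∞ (fun y ↦ G y i j) x := (hs i).gfun (hs j) x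
  have hdet := contMDiffAt_det hG
  have hGx : (G x).det ≠ 0 := by
    refine Matrix.det_gram_ne_zero_iff_linearIndependent.mpr ?_
    simpa only [hsx] using b.linearIndependent
  -- Cramer's rule for the coordinates of X in the frame s: they solve the Gram system, and are
  -- smooth at x because the Gram determinant does not vanish there.
  let c : Fin (Module.finrank ℝ E) → M → ℝ := fun i y ↦
    (G y).det⁻¹ * ((G y).updateCol i fun j ↦ gfun X (s j) y).det
  have hc (i) : ContMDiffAt I 𝓘(ℝ, ℝ) ∞ (c i) x := by
    refine ContMDiffAt.mul (hdet.inv₀ hGx) (contMDiffAt_det fun j k ↦ ?_)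
    by_cases hk : k = i
    · subst hk
      simpa using h _ (hs j) x
    · simpa [Matrix.updateCol_ne hk] using hG j k
  have hsum : ContMDiffAt I (I.prod 𝓘(ℝ, E)) ∞ (T% (fun y ↦ ∑ i, c i y • s i y)) x :=
    .sum_section fun i _ ↦ (hc i).smul_section (hs i x)
  refine hsum.congr_of_eventuallyEq ?_
  filter_upwards [hdet.continuousAt.eventually_ne hGx] with y hy
  suffices X y = ∑ i, c i y • s i y by simp only [this]
  have hli : LinearIndependent ℝ fun i ↦ s i y :=
    Matrix.det_gram_ne_zero_iff_linearIndependent.mp hy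
  have hspan : Submodule.span ℝ (Set.range fun i ↦ s i y) = ⊤ :=
    hli.span_eq_top_of_card_eq_finrank' (by simp; rfl)
  have hGc : (G y).mulVec (fun i ↦ c i y) = fun j ↦ gfun X (s j) y := by
    have : (fun i ↦ c i y) = (G y).det⁻¹ • (G y).cramer fun j ↦ gfun X (s j) y :=
      funext fun i ↦ by simp [c, Matrix.cramer_apply]
    rw [this, Matrix.mulVec_smul, Matrix.mulVec_cramer, smul_smul, inv_mul_cancel₀ hy, one_smul]
  -- The Gram system says precisely that the error is orthogonal to every s j, hence to the whole
  -- tangent space.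
  have hmem : X y - ∑ i, c i y • s i y ∈ (Submodule.span ℝ (Set.range fun i ↦ s i y))ᗮ := by
    rw [Submodule.mem_orthogonal]
    intro u hu
    induction hu using Submodule.span_induction with
    | mem u hu =>
      obtain ⟨j, rfl⟩ := hu
      have := congrFun hGc j
      simp only [Matrix.mulVec, dotProduct, G, Matrix.gram_apply, gfun] at this
      simp only [inner_sub_right, inner_sum, inner_smul_right]
      rw [real_inner_comm, ← this, sub_eq_zero]
      exact Finset.sum_congr rfl fun i _ ↦ mul_comm _ _
    | zero => exact inner_zero_left _
    | add u v _ _ hu hv => rw [inner_add_left, hu, hv, add_zero]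
    | smul a u _ hu => rw [inner_smul_left, hu, mul_zero]
  rw [hspan, Submodule.top_orthogonal_eq_bot, Submodule.mem_bot] at hmem
  exact sub_eq_zero.mp hmem

lemma SmoothVF.nabla [T2Space M] (hX : SmoothVF X) (hY : SmoothVF Y) : SmoothVF (nabla X Y) := by
  refine smoothVF_of_gfun fun Z hZ ↦ ?_
  have : WeakQCM.gfun (WeakQCM.nabla X Y) Z = fun x ↦ 2⁻¹ * WeakQCM.koszul X Y Z x :=
    funext fun x ↦ inner_nabla (hX.mdiffAt x) (hY.mdiffAt x) (hZ.mdiffAt x)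
  rw [this]
  exact contMDiff_const.mul (hX.koszul hY hZ)

end Metric

/-! ### Tensoriality, Killing fields and the weak quasi-contact structure -/

section Structure

variable {E : Type*} [NormedAddCommGroup E] [NormedSpace ℝ E] [FiniteDimensional ℝ E]
  {H : Type*} [TopologicalSpace H] {I : ModelWithCorners ℝ E H}
  {M : Type*} [TopologicalSpace M] [T2Space M] [ChartedSpace H M] [IsManifold I ∞ M]
  [RiemannianBundle (fun x : M ↦ TangentSpace I x)]
  [IsContMDiffRiemannianBundle I ∞ E (fun x : M ↦ TangentSpace I x)]
  {X Y Z ξ : Π x : M, TangentSpace I x} {f Q : Π x : M, TangentSpace I x →L[ℝ] TangentSpace I x}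
  {η : Π x : M, TangentSpace I x →L[ℝ] ℝ}

/-- The covariant derivative of a skew-symmetric endomorphism field is skew-symmetric. -/
lemma inner_nablaEnd (hf : SmoothEnd f)
    (hskew : ∀ x (u v : TangentSpace I x), (inner ℝ (f x u) v : ℝ) = -inner ℝ u (f x v))
    (hX : SmoothVF X) (hY : SmoothVF Y) (hZ : SmoothVF Z) (x : M) :
    (inner ℝ (nablaEnd f X Y x) (Z x) : ℝ) = -inner ℝ (Y x) (nablaEnd f X Z x) := by
  -- Differentiate this identity of functions along X.
  have h : gfun (app f Y) Z = -gfun Y (app f Z) := funext fun y ↦ hskew y _ _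
  have h1 := mvfderiv_gfun (hX.mdiffAt x) ((hf.app hY).mdiffAt x) (hZ.mdiffAt x)
  have h2 := mvfderiv_gfun (hX.mdiffAt x) (hY.mdiffAt x) ((hf.app hZ).mdiffAt x)
  rw [h, mvfderiv_neg, _root_.neg_apply, h2] at h1
  simp only [nablaEnd, inner_sub_left, inner_sub_right]
  simp only [app, hskew] at h1 ⊢
  linarith

/-- The covariant derivative of a skew-symmetric endomorphism field is a tensor. -/
lemma exists_nablaEnd_eq (hf : SmoothEnd f)
    (hskew : ∀ x (u v : TangentSpace I x), (inner ℝ (f x u) v : ℝ) = -inner ℝ u (f x v)) (x : M) :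
    ∃ T : TangentSpace I x → TangentSpace I x → TangentSpace I x,
      (∀ X Y : Π x : M, TangentSpace I x, SmoothVF X → SmoothVF Y →
        nablaEnd f X Y x = T (X x) (Y x)) ∧
      (∀ v, T 0 v = 0) ∧ ∀ u v w, (inner ℝ (T u v) w : ℝ) = -inner ℝ v (T u w) := by
  choose F hF hFx using exists_smoothVF (I := I) (M := M) x
  have key {X X' : Π x : M, TangentSpace I x} (Y) (h : X x = X' x) :
      nablaEnd f X Y x = nablaEnd f X' Y x := by
    simp only [nablaEnd, nabla, h]
  -- Dependence on X only through X x is built into `nabla`. For Y, skewness moves the derivative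
  -- onto the test field, leaving only the value Y x.
  refine ⟨fun u v ↦ nablaEnd f (F u) (F v) x, fun X Y hX hY ↦ ?_, fun v ↦ ?_, fun u v w ↦ ?_⟩
  · rw [key Y (hFx (X x)).symm]
    refine ext_inner_right ℝ fun w ↦ ?_
    rw [← hFx w, inner_nablaEnd hf hskew (hF _) hY (hF _),
      inner_nablaEnd hf hskew (hF _) (hF _) (hF _), hFx]
  · simp only [nablaEnd, nabla, hFx, map_zero, sub_zero]
  · have := inner_nablaEnd hf hskew (hF u) (hF v) (hF w) x
    rwa [hFx, hFx] at this

/-- The endomorphism `∇ξ` of a Killing vector field `ξ` is skew-symmetric. -/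
lemma IsKilling.inner_leviCivita (hξ : IsKilling ξ) (x : M) (u v : TangentSpace I x) :
    (inner ℝ (leviCivita I M ξ x u) v : ℝ) = -inner ℝ u (leviCivita I M ξ x v) := by
  obtain ⟨X, hX, rfl⟩ := exists_smoothVF x u
  obtain ⟨Y, hY, rfl⟩ := exists_smoothVF x v
  have := hξ X Y hX hY x
  rw [eq_neg_iff_add_eq_zero, real_inner_comm (leviCivita I M ξ x (Y x))]
  exact this

/-- A Killing vector field of unit length is geodesic. -/
lemma IsKilling.leviCivita_self (hξ : IsKilling ξ) (hs : SmoothVF ξ)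
    (h1 : ∀ x, (inner ℝ (ξ x) (ξ x) : ℝ) = 1) (x : M) : leviCivita I M ξ x (ξ x) = 0 := by
  refine ext_inner_right ℝ fun u ↦ ?_
  obtain ⟨X, hX, rfl⟩ := exists_smoothVF x u
  have hconst : gfun ξ ξ = fun _ : M ↦ (1 : ℝ) := funext h1
  have h := mvfderiv_gfun (hX.mdiffAt x) (hs.mdiffAt x) (hs.mdiffAt x)
  rw [hconst, mvfderiv_const, _root_.zero_apply, real_inner_comm] at h
  have h' : (inner ℝ (ξ x) (leviCivita I M ξ x (X x)) : ℝ) = 0 := by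
    change (0 : ℝ) = inner ℝ (ξ x) (leviCivita I M ξ x (X x))
      + inner ℝ (ξ x) (leviCivita I M ξ x (X x)) at h
    linarith
  -- ⟨∇_ξ ξ, X⟩ = -⟨ξ, ∇_X ξ⟩, which is minus half the derivative of |ξ|² = 1.
  rw [hξ.inner_leviCivita, h', neg_zero, inner_zero_left]

/-- For a unit Killing vector field `ξ` with `R_{X,ξ}ξ = X - η(X)ξ`, the square of `∇ξ` is
`-id + η ⊗ ξ`. -/
lemma IsKilling.leviCivita_sq (hξ : IsKilling ξ) (hs : SmoothVF ξ)
    (h1 : ∀ x, (inner ℝ (ξ x) (ξ x) : ℝ) = 1)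
    (hR : ∀ X : Π x : M, TangentSpace I x, SmoothVF X →
      ∀ x, curvature X ξ ξ x = X x - (inner ℝ (ξ x) (X x) : ℝ) • ξ x)
    (x : M) (u : TangentSpace I x) :
    leviCivita I M ξ x (leviCivita I M ξ x u) = -u + (inner ℝ (ξ x) u : ℝ) • ξ x := by
  set A := leviCivita I M ξ x with hA
  have hgeo : nabla ξ ξ = 0 := funext fun y ↦ hξ.leviCivita_self hs h1 y
  -- R_{X,ξ}ξ = -(∇_ξ A)X - A²X. The first operator is skew by `hskew`, whereas A² and id - η ⊗ ξ
  -- are symmetric; adding the pairings for (X, Y) and (Y, X) therefore isolates A².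
  have hcurv {X : Π x : M, TangentSpace I x} (hX : SmoothVF X) :
      curvature X ξ ξ x = -(nabla ξ (nabla X ξ) x - A (nabla ξ X x)) - A (A (X x)) := by
    have h0 : nabla X (0 : Π x : M, TangentSpace I x) x = 0 := by
      simp [nabla, CovariantDerivative.zero]
    have hbr : nabla (VectorField.mlieBracket I X ξ) ξ x = A (A (X x)) - A (nabla ξ X x) := by
      change A (VectorField.mlieBracket I X ξ x) = _
      rw [← nabla_sub_nabla (hX.mdiffAt x) (hs.mdiffAt x), map_sub]
      rfl
    rw [curvature, hgeo, h0, hbr]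
    abel
  have hskew {X Y : Π x : M, TangentSpace I x} (hX : SmoothVF X) (hY : SmoothVF Y) :
      (inner ℝ (nabla ξ (nabla X ξ) x - A (nabla ξ X x)) (Y x) : ℝ)
        + inner ℝ (nabla ξ (nabla Y ξ) x - A (nabla ξ Y x)) (X x) = 0 := by
    have h : gfun (nabla X ξ) Y = -gfun (nabla Y ξ) X :=
      funext fun y ↦ eq_neg_of_add_eq_zero_left (hξ X Y hX hY y)
    have e1 := mvfderiv_gfun (hs.mdiffAt x) ((hX.nabla hs).mdiffAt x) (hY.mdiffAt x)
    have e2 := mvfderiv_gfun (hs.mdiffAt x) ((hY.nabla hs).mdiffAt x) (hX.mdiffAt x)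
    rw [h, mvfderiv_neg, _root_.neg_apply, e2] at e1
    have e3 : (inner ℝ (nabla X ξ x) (nabla ξ Y x) : ℝ) = -inner ℝ (A (nabla ξ Y x)) (X x) :=
      (hξ.inner_leviCivita x (X x) (nabla ξ Y x)).trans (congrArg Neg.neg (real_inner_comm _ _))
    have e4 : (inner ℝ (nabla Y ξ x) (nabla ξ X x) : ℝ) = -inner ℝ (A (nabla ξ X x)) (Y x) :=
      (hξ.inner_leviCivita x (Y x) (nabla ξ X x)).trans (congrArg Neg.neg (real_inner_comm _ _))
    rw [inner_sub_left, inner_sub_left]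
    linarith
  refine ext_inner_right ℝ fun v ↦ ?_
  obtain ⟨X, hX, rfl⟩ := exists_smoothVF x u
  obtain ⟨Y, hY, rfl⟩ := exists_smoothVF x v
  have hX' := congrArg (fun z ↦ (inner ℝ z (Y x) : ℝ)) ((hcurv hX).symm.trans (hR X hX x))
  have hY' := congrArg (fun z ↦ (inner ℝ z (X x) : ℝ)) ((hcurv hY).symm.trans (hR Y hY x))
  have hXY := hskew hX hY
  have hAA : (inner ℝ (A (A (X x))) (Y x) : ℝ) = inner ℝ (A (A (Y x))) (X x) := by
    rw [hξ.inner_leviCivita, hξ.inner_leviCivita, neg_neg, real_inner_comm]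
  simp only [inner_sub_left, inner_neg_left, real_inner_smul_left] at hX' hY' hXY
  rw [inner_add_left, inner_neg_left, real_inner_smul_left]
  rw [real_inner_comm (X x) (Y x)] at hY'
  linarith

/-- Torsion-freeness turns the Lie brackets into covariant derivatives, so that 2h = ∇_ξ f - Af + fA
with A = ∇ξ. This makes the quasi-contact identity pointwise. -/
lemma hTensor_apply (hf : SmoothEnd f) (hs : SmoothVF ξ) (hX : SmoothVF X) (x : M) :
    hTensor f ξ X x = (1 / 2 : ℝ) • (nablaEnd f ξ X x - leviCivita I M ξ x (f x (X x))
      + f x (leviCivita I M ξ x (X x))) := by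
  rw [hTensor, lieEnd, ← nabla_sub_nabla (hs.mdiffAt x) ((hf.app hX).mdiffAt x),
    ← nabla_sub_nabla (hs.mdiffAt x) (hX.mdiffAt x), map_sub, nablaEnd]
  congr 1
  change _ - leviCivita I M ξ x (f x (X x)) - (_ - f x (leviCivita I M ξ x (X x))) = _
  abel

/-- Metric compatibility and torsion-freeness cancel every derivative of X and Y, leaving the skew
part of ∇ξ. -/
lemma dForm_eq (hη : ∀ x (u : TangentSpace I x), η x u = inner ℝ (ξ x) u)
    (hs : SmoothVF ξ) (hX : SmoothVF X) (hY : SmoothVF Y) (x : M) :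
    dForm η X Y x = (1 / 2 : ℝ) * (inner ℝ (leviCivita I M ξ x (X x)) (Y x)
      - inner ℝ (leviCivita I M ξ x (Y x)) (X x)) := by
  have e (Z : Π x : M, TangentSpace I x) : (fun y ↦ η y (Z y)) = gfun ξ Z :=
    funext fun y ↦ hη y _
  rw [dForm, e, e, hη, mvfderiv_gfun (hX.mdiffAt x) (hs.mdiffAt x) (hY.mdiffAt x),
    mvfderiv_gfun (hY.mdiffAt x) (hs.mdiffAt x) (hX.mdiffAt x),
    ← nabla_sub_nabla (hX.mdiffAt x) (hY.mdiffAt x), inner_sub_right]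
  change _ = (1 / 2 : ℝ) * (inner ℝ (nabla X ξ x) (Y x) - inner ℝ (nabla Y ξ x) (X x))
  ring

lemma IsWeakACM.inner_xi_xi (h : IsWeakACM f Q ξ η) (x : M) : (inner ℝ (ξ x) (ξ x) : ℝ) = 1 := by
  rw [← h.eta_eq, h.eta_xi]

lemma IsWeakACM.f_sq' (h : IsWeakACM f Q ξ η) (x : M) (u : TangentSpace I x) :
    f x (f x u) = -Q x u + (inner ℝ (ξ x) u : ℝ) • ξ x := by
  rw [h.f_sq, h.eta_eq]

/-- The endomorphism `f` of a weak almost contact metric structure is skew-symmetric. -/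
lemma IsWeakACM.skew (h : IsWeakACM f Q ξ η) (x : M) (u v : TangentSpace I x) :
    (inner ℝ (f x u) v : ℝ) = -inner ℝ u (f x v) := by
  have : FiniteDimensional ℝ (TangentSpace I x) := inferInstanceAs (FiniteDimensional ℝ E)
  refine skew_of_inner_map_map (f := (f x).toLinearMap) (fun u v ↦ ?_) u v
  change (inner ℝ (f x u) (f x v) : ℝ) = -inner ℝ u (f x (f x v))
  rw [h.compat, h.f_sq, inner_add_right, inner_neg_right, real_inner_smul_right,
    real_inner_comm (ξ x) u, ← h.eta_eq]
  ring

/-- The defining identity of a weak quasi-contact metric structure, in terms of vectors. -/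
lemma IsWeakQCM.quasi_apply (h : IsWeakQCM f Q ξ η) {x : M}
    {T : TangentSpace I x → TangentSpace I x → TangentSpace I x}
    (hT : ∀ X Y : Π x : M, TangentSpace I x, SmoothVF X → SmoothVF Y →
      nablaEnd f X Y x = T (X x) (Y x)) (u v : TangentSpace I x) :
    T u v + T (f x u) (f x v) = (2 * inner ℝ u v : ℝ) • ξ x
      - (inner ℝ (ξ x) v : ℝ) • (u + (1 / 2 : ℝ) • (T (ξ x) u - leviCivita I M ξ x (f x u)
        + f x (leviCivita I M ξ x u)) + (inner ℝ (ξ x) u : ℝ) • ξ x) := by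
  obtain ⟨X, hX, rfl⟩ := exists_smoothVF x u
  obtain ⟨Y, hY, rfl⟩ := exists_smoothVF x v
  have := h.quasi X Y hX hY x
  rwa [hTensor_apply h.smooth_f h.smooth_xi hX, hT _ _ hX hY, hT _ _ h.smooth_xi hX,
    hT _ _ (h.smooth_f.app hX) (h.smooth_f.app hY), h.eta_eq, h.eta_eq] at this

/-- On an odd-dimensional weak quasi-contact metric manifold we have `f ξ = 0`. -/
lemma IsWeakQCM.f_xi (h : IsWeakQCM f Q ξ η) (hodd : Odd (Module.finrank ℝ E)) (x : M) :
    f x (ξ x) = 0 := by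
  have : FiniteDimensional ℝ (TangentSpace I x) := inferInstanceAs (FiniteDimensional ℝ E)
  obtain ⟨T, hT, T_zero, T_skew⟩ := exists_nablaEnd_eq h.smooth_f h.skew x
  obtain ⟨w, hw0, hw⟩ := exists_map_eq_zero_of_skew (f := (f x).toLinearMap) hodd (h.skew x)
  replace hw : f x w = 0 := hw
  -- Because f w = 0, the term T (f w) (f v) vanishes and the identity describes T w alone. The
  -- vector a is h w, orthogonal to w since T ξ and f are skew and f w = 0.
  refine map_xi_eq_zero (f := (f x).toLinearMap) (Q := (Q x).toLinearMap) (S := T w)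
    (a := (1 / 2 : ℝ) • (T (ξ x) w - leviCivita I M ξ x (f x w) + f x (leviCivita I M ξ x w)))
    (h.nonsingular x).injective (h.inner_xi_xi x) (h.f_sq' x) hw0 hw ?_ (fun v ↦ ?_) fun v ↦ ?_
  · have h1 := T_skew (ξ x) w w
    rw [real_inner_comm (T (ξ x) w) w] at h1
    rw [hw, map_zero, real_inner_smul_left, inner_add_left, inner_sub_left, h.skew, hw,
      inner_zero_left, inner_zero_right]
    linarith
  · rw [← h.quasi_apply hT, hw, T_zero, add_zero]
  · have h1 := T_skew w v v
    rw [real_inner_comm] at h1 ⊢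
    linarith

/-- Feeds the geometry into `eq_id_and_eq_neg` at the point x, with A = ∇ξ and T = ∇f. -/
lemma IsWeakQCM.eq_id_and_leviCivita_eq (h : IsWeakQCM f Q ξ η) (hξ : IsKilling ξ)
    (hodd : Odd (Module.finrank ℝ E))
    (hR : ∀ X : Π x : M, TangentSpace I x, SmoothVF X →
      ∀ x, curvature X ξ ξ x = X x - η x (X x) • ξ x) (x : M) :
    (∀ u, Q x u = u) ∧ ∀ u, leviCivita I M ξ x u = -f x u := by
  obtain ⟨T, hT, T_zero, T_skew⟩ := exists_nablaEnd_eq h.smooth_f h.skew x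
  have hfξ := h.f_xi hodd
  have T_xi (u : TangentSpace I x) : T u (ξ x) = -f x (leviCivita I M ξ x u) := by
    obtain ⟨X, hX, rfl⟩ := exists_smoothVF x u
    -- Here fξ = 0 is needed as a field, not only at x, since fξ is differentiated.
    rw [← hT X ξ hX h.smooth_xi, nablaEnd, show app f ξ = 0 from funext hfξ]
    simp [nabla, CovariantDerivative.zero]
  refine eq_id_and_eq_neg (f := (f x).toLinearMap) (Q := (Q x).toLinearMap)
    (A := (leviCivita I M ξ x).toLinearMap) (h.nonsingular x).injective (h.inner_xi_xi x)
    (h.f_sq' x) (h.skew x) (hfξ x) (hξ.inner_leviCivita x)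
    (hξ.leviCivita_self h.smooth_xi h.inner_xi_xi x)
    (hξ.leviCivita_sq h.smooth_xi h.inner_xi_xi (fun X hX y ↦ ?_) x) T_zero T_skew T_xi
    (h.quasi_apply hT)
  rw [hR X hX, h.eta_eq]

end Structure

end WeakQCM

theorem theorem3p7 (n : ℕ) {M : Type*} [TopologicalSpace M] [T2Space M]
    [ChartedSpace (EuclideanSpace ℝ (Fin (2 * n + 1))) M] [IsManifold (𝓡 (2 * n + 1)) ∞ M]
    [RiemannianBundle (fun x : M ↦ TangentSpace (𝓡 (2 * n + 1)) x)]
    [IsContMDiffRiemannianBundle (𝓡 (2 * n + 1)) ∞ (EuclideanSpace ℝ (Fin (2 * n + 1)))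
      (fun x : M ↦ TangentSpace (𝓡 (2 * n + 1)) x)]
    (f Q : Π x : M, TangentSpace (𝓡 (2 * n + 1)) x →L[ℝ] TangentSpace (𝓡 (2 * n + 1)) x)
    (ξ : Π x : M, TangentSpace (𝓡 (2 * n + 1)) x)
    (η : Π x : M, TangentSpace (𝓡 (2 * n + 1)) x →L[ℝ] ℝ)
    (hM : WeakQCM.IsWeakQCM f Q ξ η)
    (hR : ∀ X : Π x : M, TangentSpace (𝓡 (2 * n + 1)) x, WeakQCM.SmoothVF X →
      ∀ x, WeakQCM.curvature X ξ ξ x = X x - η x (X x) • ξ x)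
    (hξ : WeakQCM.IsKilling ξ) :
    (∀ x, Q x = ContinuousLinearMap.id ℝ (TangentSpace (𝓡 (2 * n + 1)) x)) ∧
      WeakQCM.IsKContact f ξ η := by
  have key := hM.eq_id_and_leviCivita_eq hξ (by simp) hR
  have hQ (x : M) : Q x = ContinuousLinearMap.id ℝ (TangentSpace (𝓡 (2 * n + 1)) x) :=
    ContinuousLinearMap.ext (key x).1
  refine ⟨hQ, ⟨?_, fun X Y hX hY x ↦ ?_⟩, hξ⟩
  · have := hM.toIsWeakACM
    rwa [funext hQ] at this
  · rw [WeakQCM.dForm_eq hM.eta_eq hM.smooth_xi hX hY, (key x).2, (key x).2, inner_neg_left,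
      inner_neg_left, hM.skew, real_inner_comm]
    ring
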